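/- Let $\mathbb K$ be a real-closed ordered field with order $\preceq$, let $V$ be a finite set with $N=\#V\ge 2$ elements, and let $b:V\times V\to\mathbb K$ satisfy $b(x,y)\succeq 0$, $b(x,y)=b(y,x)$ and $b(x,x)=0$ for all $x,y\in V$. Put $b(x)=\sum_{y\in V}b(x,y)$ and suppose that $b(x)\neq 0$ for every $x\in V$ (no isolated vertices). For $V_1,V_2\subset V$ put $b(V_1)=\sum_{x\in V_1}b(x)$ and $b(V_1,V_2)=\sum_{x\in V_1,\,y\in V_2}b(x,y)$, and let $$\overline h=\max_{\substack{\emptyset\ne V_1\subset V,\ \emptyset\ne V_2\subset V,\\ V_1\cap V_2=\emptyset}}\frac{2b(V_1,V_2)}{b(V_1)+b(V_2)}$$ be the dual Cheeger constant. Let $\mathcal L$ be the normalized Laplacian on the functions $f:V\to\mathbb K$, $$\mathcal Lf(x)=\sum_{y\in V}(f(x)-f(y))\frac{b(x,y)}{b(x)}.$$ Then $\mathcal L$ has a largest eigenvalue $\lambda_{N-1}$ in $\mathbb K$, the element $1-(1-\overline h)^2$ has a nonnegative square root in $\mathbb K$, and $$2\overline h\preceq\lambda_{N-1}\preceq 1+\sqrt{1-(1-\overline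 h)^2}.$$ -/

import Mathlib

/-- A graph over an ordered field `K` with vertex set `V`: symmetric nonnegative edge weights `b`,
vanishing on the diagonal (no loops). -/
structure OFGraph (V K : Type*) [Zero K] [LE K] where
  b : V → V → K
  nonneg : ∀ x y, 0 ≤ b x y
  symm : ∀ x y, b x y = b y x
  loopless : ∀ x, b x x = 0

namespace OFGraph

variable {V K : Type*} [Fintype V] [Field K] [LinearOrder K]

/-- The weight `b(x) = ∑_y b(x,y)` of a vertex. -/
def deg (G : OFGraph V K) (x : V) : K := ∑ y, G.b x y

/-- The weight `b(V₁) = ∑_{x ∈ V₁} b(x)` of a set of vertices. -/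
def vol (G : OFGraph V K) (S : Finset V) : K := ∑ x ∈ S, G.deg x

/-- The weight `b(V₁,V₂) = ∑_{x ∈ V₁, y ∈ V₂} b(x,y)` of the edges between two sets. -/
def cut (G : OFGraph V K) (S T : Finset V) : K := ∑ x ∈ S, ∑ y ∈ T, G.b x y

/-- A vertex is isolated if its weight is zero. -/
def IsIsolated (G : OFGraph V K) (x : V) : Prop := G.deg x = 0

/-- The normalized weight `p(x,y) = b(x,y) / b(x)`. -/
def p (G : OFGraph V K) (x y : V) : K := G.b x y / G.deg x

/-- The normalized Laplace operator on the functions `V → K`. -/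
def laplacian (G : OFGraph V K) : Module.End K (V → K) where
  toFun f x := ∑ y, (f x - f y) * G.p x y
  map_add' f g := by
    funext x
    simp only [Pi.add_apply, ← Finset.sum_add_distrib]
    exact Finset.sum_congr rfl fun y _ => by ring
  map_smul' c f := by
    funext x
    simp only [Pi.smul_apply, smul_eq_mul, RingHom.id_apply, Finset.mul_sum]
    exact Finset.sum_congr rfl fun y _ => by ring

/-- The pairs of nonempty disjoint sets of vertices. -/
def disjointPairs (V : Type*) [Fintype V] [DecidableEq V] : Finset (Finset V × Finset V) :=
  {P | P.1.Nonempty ∧ P.2.Nonempty ∧ Disjoint P.1 P.2}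

theorem disjointPairs_nonempty (V : Type*) [Fintype V] [DecidableEq V] [Nontrivial V] :
    (disjointPairs V).Nonempty := by
  obtain ⟨x, y, hxy⟩ := exists_pair_ne V
  exact ⟨({x}, {y}), by simp [disjointPairs, hxy]⟩

/-- The dual Cheeger constant: the maximum of `2 b(V₁,V₂) / (b(V₁) + b(V₂))` over all pairs of
nonempty disjoint sets of vertices. -/
def dualCheeger [DecidableEq V] [Nontrivial V] (G : OFGraph V K) : K :=
  (disjointPairs V).sup' (disjointPairs_nonempty V)
    fun P => 2 * G.cut P.1 P.2 / (G.vol P.1 + G.vol P.2)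

end OFGraph

/-! The Laplacian `L` is self-adjoint for the inner product `⟨f, g⟩ = ∑ b(x) f(x) g(x)`.
Self-adjoint operators over a real closed field `K` have eigenvalues: if `q` is irreducible over `K`
and `q(L) v = 0` with `v ≠ 0`, positivity of `⟨g(L) v, g(L) v⟩` shows that `-1` is not a sum of
squares in `K[X]/(q)`. But Galois groups over `K` are 2-groups, so every proper finite extension of
`K` contains a quadratic one and with it a square root of `-1`; hence `q` is linear. As usual, `L`
is then diagonalizable and its largest eigenvalue bounds the Rayleigh quotients.

Since `⟨f, L f⟩ = ⟨f, f⟩ - ∑ b(x,y) f(x) f(y)`, the test functions `1_S - 1_T` give the lower bound.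
For the upper bound, let `u` and `v` be the positive and negative parts of an eigenfunction and put
`F = ⟨u, u⟩ + ⟨v, v⟩`. Slicing `u²` and `v²` into layers gives `2 ∑ b(x,y) min(u(x)², v(y)²) ≤ h F`,
that is, `(1 - h) F ≤ ∑ b(x,y) |u(x)² - v(y)²|`, and by the Cauchy–Schwarz inequality the square of
the right-hand side is at most `F² - (2 ∑ b(x,y) u(x) v(y))²`. -/

section RealClosedField

variable {K E : Type*} [Field K] [IsRealClosed K] [Field E] [Algebra K E] [FiniteDimensional K E]

open Polynomial in
theorem finrank_eq_one_of_isRealClosed_of_odd_finrank (hodd : Odd (Module.finrank K E)) :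
    Module.finrank K E = 1 := by
  obtain ⟨α, hα⟩ := Field.exists_primitive_element K E
  have hint : IsIntegral K α := Algebra.IsIntegral.isIntegral α
  have hdeg := (Field.primitive_element_iff_minpoly_natDegree_eq K α).1 hα
  obtain ⟨r, hr⟩ := IsRealClosed.exists_isRoot_of_odd_natDegree (hdeg ▸ hodd)
  rw [← hdeg]
  exact natDegree_eq_of_degree_eq_some
    (degree_eq_one_of_irreducible_of_root (minpoly.irreducible hint) hr)

theorem isPGroup_two_gal_of_isRealClosed [IsGalois K E] : IsPGroup 2 Gal(E/K) := by
  have : Fact (Nat.Prime 2) := ⟨Nat.prime_two⟩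
  let P : Sylow 2 Gal(E/K) := default
  have hindex : (P : Subgroup Gal(E/K)).index =
      Module.finrank K (IntermediateField.fixedField (P : Subgroup Gal(E/K))) := by
    rw [IntermediateField.finrank_eq_fixingSubgroup_index,
      IntermediateField.fixingSubgroup_fixedField]
  have hodd : Odd (P : Subgroup Gal(E/K)).index := by
    rw [← Nat.not_even_iff_odd, even_iff_two_dvd]
    exact P.not_dvd_index
  have htop : (P : Subgroup Gal(E/K)) = ⊤ := by
    rw [← Subgroup.index_eq_one, hindex]
    exact finrank_eq_one_of_isRealClosed_of_odd_finrank (hindex ▸ hodd)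
  exact (htop ▸ P.isPGroup').of_equiv Subgroup.topEquiv

theorem exists_le_index_eq_of_isPGroup {G : Type*} [Group G] [Finite G] {p : ℕ} [Fact p.Prime]
    (hG : IsPGroup p G) {H : Subgroup G} (hH : H ≠ ⊤) : ∃ M, H ≤ M ∧ M.index = p := by
  obtain ⟨m, hm⟩ := IsPGroup.iff_card.1 hG
  obtain ⟨n, hn⟩ := IsPGroup.iff_card.1 (hG.to_subgroup H)
  have hp := (Fact.out : p.Prime)
  have hnm : n < m := by
    rw [← Nat.pow_lt_pow_iff_right hp.one_lt, ← hn, ← hm]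
    exact H.card_le_card_group.lt_of_ne (mt H.eq_top_of_card_eq hH)
  obtain ⟨M, hM, hle⟩ := Sylow.exists_subgroup_card_pow_prime_le p
    (hm ▸ pow_dvd_pow p (Nat.sub_le m 1)) H hn (Nat.le_sub_one_of_lt hnm)
  refine ⟨M, hle, Nat.eq_of_mul_eq_mul_left (pow_pos hp.pos (m - 1)) ?_⟩
  rw [← hM, M.card_mul_index, hm, hM, ← pow_succ, Nat.sub_add_cancel (Nat.one_le_of_lt hnm)]

theorem exists_le_finrank_eq_of_isPGroup_gal {k N : Type*} [Field k] [Field N] [Algebra k N]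
    [FiniteDimensional k N] [IsGalois k N] {p : ℕ} [Fact p.Prime] (hG : IsPGroup p Gal(N/k))
    {F : IntermediateField k N} (hF : F ≠ ⊥) :
    ∃ E : IntermediateField k N, E ≤ F ∧ Module.finrank k E = p := by
  have htop : F.fixingSubgroup ≠ ⊤ := fun h => hF <| by
    rw [← IsGalois.fixedField_fixingSubgroup F, h, IsGalois.fixedField_top]
  obtain ⟨M, hle, hM⟩ := exists_le_index_eq_of_isPGroup hG htop
  refine ⟨IntermediateField.fixedField M, ?_, ?_⟩
  · rw [← IsGalois.fixedField_fixingSubgroup F]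
    exact IntermediateField.fixedField_antitone hle
  · rw [IntermediateField.finrank_eq_fixingSubgroup_index,
      IntermediateField.fixingSubgroup_fixedField, hM]

theorem exists_mul_self_eq_neg_one_of_isQuadraticExtension (K E : Type*) [Field K] [IsRealClosed K]
    [Field E] [Algebra K E] [Algebra.IsQuadraticExtension K E] : ∃ i : E, i * i = -1 := by
  have hfinrank := Algebra.IsQuadraticExtension.finrank_eq_two K E
  have hroots : (primitiveRoots (Module.finrank K E) K).Nonempty :=
    ⟨-1, (mem_primitiveRoots (by lia)).2 <| hfinrank ▸ IsPrimitiveRoot.neg_one 0 (by simp)⟩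
  obtain ⟨y, ⟨d, hd⟩, hy⟩ := exists_root_adjoin_eq_top_of_isCyclic K E hroots
  rw [hfinrank, sq] at hd
  have hy_base : y ∉ (⊥ : IntermediateField K E) := fun h => by
    have := IntermediateField.bot_eq_top_iff_finrank_eq_one.1 <|
      (IntermediateField.adjoin_simple_eq_bot_iff.2 h).symm.trans hy
    lia
  rcases IsRealClosed.isSquare_or_isSquare_neg d with ⟨e, he⟩ | ⟨e, he⟩
  · rw [he, map_mul, mul_self_eq_mul_self_iff] at hd
    rcases hd with h | h
    · exact absurd ⟨e, h⟩ hy_base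
    · exact absurd ⟨-e, by simp [h]⟩ hy_base
  · have hy0 : y ≠ 0 := fun h => hy_base (h ▸ zero_mem _)
    refine ⟨algebraMap K E e / y, ?_⟩
    rw [div_mul_div_comm, ← map_mul, ← he, map_neg, hd, neg_div, div_self (mul_ne_zero hy0 hy0)]

theorem finrank_eq_one_of_isRealClosed_of_isSemireal [IsSemireal E] : Module.finrank K E = 1 := by
  by_contra hne
  have : Fact (Nat.Prime 2) := ⟨Nat.prime_two⟩
  let N := IntermediateField.normalClosure K E (AlgebraicClosure E)
  have : IsGalois K N := ⟨⟩
  let φ : E →ₐ[K] N := IsScalarTower.toAlgHom K E N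
  have hφ : φ.fieldRange ≠ ⊥ := fun h => hne <| by
    rw [(AlgEquiv.ofInjectiveField φ).toLinearEquiv.finrank_eq]
    exact IntermediateField.finrank_eq_one_iff.2 h
  obtain ⟨Q, hQ, hQ2⟩ := exists_le_finrank_eq_of_isPGroup_gal
    (isPGroup_two_gal_of_isRealClosed (K := K) (E := N)) hφ
  have : Algebra.IsQuadraticExtension K Q := ⟨hQ2⟩
  obtain ⟨i, hi⟩ := exists_mul_self_eq_neg_one_of_isQuadraticExtension K Q
  obtain ⟨z, hz⟩ := hQ i.2
  refine IsSemireal.not_isSumSq_neg_one (R := E) ?_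
  rw [← (φ : E →+* N).injective (a₁ := z * z) (a₂ := -1) ?_]
  · exact IsSumSq.mul_self z
  · rw [map_mul, map_neg, map_one, show (φ : E →+* N) z = i from hz]
    exact congrArg Subtype.val hi

end RealClosedField

section SelfAdjoint

open Polynomial

theorem isSelfAdjoint_aeval {R M : Type*} [CommRing R] [AddCommGroup M] [Module R M]
    {B : LinearMap.BilinForm R M} {T : Module.End R M} (hT : B.IsSelfAdjoint T) (q : R[X]) :
    B.IsSelfAdjoint (aeval T q) := by
  induction q using Polynomial.induction_on with
  | C a => intro v w; simp [Module.algebraMap_end_apply]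
  | add p q hp hq => intro v w; simp [hp v w, hq v w]
  | monomial n a ih =>
    intro v w
    have hcomm := (commute_X (C a * X ^ n)).map (aeval T)
    rw [aeval_X] at hcomm
    rw [pow_succ, ← mul_assoc, map_mul, Module.End.mul_apply, ih, aeval_X, hT,
      ← Module.End.mul_apply, hcomm.eq]

theorem apply_eq_zero_of_mem_eigenspace_of_ne {R M : Type*} [CommRing R] [NoZeroDivisors R]
    [AddCommGroup M] [Module R M] {B : LinearMap.BilinForm R M} {T : Module.End R M}
    (hT : B.IsSelfAdjoint T)
    {μ ν : R} (hne : μ ≠ ν) {v w : M} (hv : v ∈ T.eigenspace μ) (hw : w ∈ T.eigenspace ν) :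
    B v w = 0 := by
  have h := hT v w
  rw [Module.End.mem_eigenspace_iff.1 hv, Module.End.mem_eigenspace_iff.1 hw, map_smul,
    LinearMap.smul_apply, map_smul, ← sub_eq_zero, ← sub_smul, smul_eq_zero] at h
  exact h.resolve_left (sub_ne_zero.2 hne)

variable {K M : Type*} [Field K] [LinearOrder K] [IsStrictOrderedRing K]
  [AddCommGroup M] [Module K M] {B : LinearMap.BilinForm K M} {T : Module.End K M}

theorem isSemireal_adjoinRoot_of_isSelfAdjoint (hB : B.toQuadraticMap.PosDef)
    (hT : B.IsSelfAdjoint T) {q : K[X]} {v : M} (hv : v ≠ 0) (hq : aeval T q v = 0) :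
    IsSemireal (AdjoinRoot q) := by
  have nonneg_of_isSumSq (s : AdjoinRoot q) (hs : IsSumSq s) :
      ∀ g : K[X], AdjoinRoot.mk q g = s → 0 ≤ B (aeval T g v) v := by
    induction hs with
    | zero =>
      intro g hg
      obtain ⟨r, rfl⟩ := AdjoinRoot.mk_eq_zero.1 hg
      rw [mul_comm, map_mul, Module.End.mul_apply, hq, map_zero, map_zero, LinearMap.zero_apply]
    | sq_add a _ ih =>
      intro g hg
      obtain ⟨r, rfl⟩ := AdjoinRoot.mk_surjective a
      have hsub := ih (g - r * r) (by rw [map_sub, map_mul, hg, add_sub_cancel_left])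
      have hsq : 0 ≤ B (aeval T (r * r) v) v := by
        rw [map_mul, Module.End.mul_apply, isSelfAdjoint_aeval hT]
        exact hB.nonneg (aeval T r v)
      rw [map_sub, LinearMap.sub_apply, map_sub, LinearMap.sub_apply] at hsub
      linarith
  refine IsSemireal.of_not_isSumSq_neg_one fun h => (hB v hv).not_ge ?_
  simpa using nonneg_of_isSumSq _ h (-1) (by simp)

theorem apply_self_apply_le_of_iSup_eigenspace_eq_top (hB : ∀ v, 0 ≤ B v v)
    (hT : B.IsSelfAdjoint T) (htop : ⨆ μ, T.eigenspace μ = ⊤) {lam : K}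
    (hlam : lam ∈ upperBounds {μ | T.HasEigenvalue μ}) (v : M) : B v (T v) ≤ lam * B v v := by
  obtain ⟨c, hc, rfl⟩ := (Submodule.mem_iSup_iff_exists_finsupp _ v).1 (htop ▸ Submodule.mem_top)
  have hdiag (w : K → M) (hw : ∀ μ, w μ ∈ T.eigenspace μ) :
      B (∑ μ ∈ c.support, c μ) (∑ μ ∈ c.support, w μ) = ∑ μ ∈ c.support, B (c μ) (w μ) := by
    simp only [map_sum, LinearMap.sum_apply]
    exact Finset.sum_congr rfl fun μ hμ => Finset.sum_eq_single_of_mem μ hμ fun ν _ hne =>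
      apply_eq_zero_of_mem_eigenspace_of_ne hT hne (hc ν) (hw μ)
  have hTc (μ : K) : T (c μ) = μ • c μ := Module.End.mem_eigenspace_iff.1 (hc μ)
  rw [Finsupp.sum, map_sum T, hdiag _ fun μ => hTc μ ▸ Submodule.smul_mem _ μ (hc μ), hdiag _ hc,
    Finset.mul_sum]
  refine Finset.sum_le_sum fun μ hμ => ?_
  rw [hTc, map_smul, smul_eq_mul]
  exact mul_le_mul_of_nonneg_right (hlam <| Module.End.hasEigenvalue_of_hasEigenvector
    ⟨hc μ, Finsupp.mem_support_iff.1 hμ⟩) (hB _)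

variable [IsRealClosed K] [FiniteDimensional K M]

theorem exists_hasEigenvalue_of_isSelfAdjoint [Nontrivial M] (hB : B.toQuadraticMap.PosDef)
    (hT : B.IsSelfAdjoint T) : ∃ μ, T.HasEigenvalue μ := by
  have hint : IsIntegral K T := Algebra.IsIntegral.isIntegral T
  obtain ⟨q, hq, r, hr⟩ := WfDvdMonoid.exists_irreducible_factor (minpoly.not_isUnit K T)
    (minpoly.ne_zero hint)
  have hr_aeval : aeval T r ≠ 0 := fun h => hq.not_isUnit <| by
    have hr0 : r ≠ 0 := by rintro rfl; exact minpoly.ne_zero hint (by rw [hr, mul_zero])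
    have := minpoly.dvd K T h
    rw [hr, mul_comm] at this
    exact isUnit_of_dvd_one ((mul_dvd_mul_iff_left hr0).1 (by rwa [mul_one]))
  obtain ⟨w, hw⟩ : ∃ w, aeval T r w ≠ 0 := by
    by_contra! h
    exact hr_aeval (LinearMap.ext h)
  have hqv : aeval T q (aeval T r w) = 0 := by
    rw [← Module.End.mul_apply, ← map_mul, ← hr, minpoly.aeval, LinearMap.zero_apply]
  have : Fact (Irreducible q) := ⟨hq⟩
  have : FiniteDimensional K (AdjoinRoot q) := (AdjoinRoot.powerBasis hq.ne_zero).finite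
  have := isSemireal_adjoinRoot_of_isSelfAdjoint hB hT hw hqv
  have hdeg : q.degree = 1 := by
    have := finrank_eq_one_of_isRealClosed_of_isSemireal (K := K) (E := AdjoinRoot q)
    rw [(AdjoinRoot.powerBasis hq.ne_zero).finrank, AdjoinRoot.powerBasis_dim] at this
    rw [degree_eq_natDegree hq.ne_zero, this, Nat.cast_one]
  refine ⟨-q.coeff 0 / q.leadingCoeff, Module.End.hasEigenvalue_of_hasEigenvector ⟨?_, hw⟩⟩
  exact (Module.End.eigenspace_aeval_polynomial_degree_1 T q hdeg).ge hqv

theorem iSup_eigenspace_eq_top_of_isSelfAdjoint (hB : B.toQuadraticMap.PosDef) (hBsymm : B.IsSymm)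
    (hT : B.IsSelfAdjoint T) : ⨆ μ, T.eigenspace μ = ⊤ := by
  set W := ⨆ μ, T.eigenspace μ
  have hdisj : Disjoint W (B.orthogonal W) := by
    rw [Submodule.disjoint_def]
    intro v hv hv'
    by_contra h
    exact (hB v h).ne' (hv' v hv)
  have hcompl := (LinearMap.BilinForm.isCompl_orthogonal_iff_disjoint hBsymm.isRefl).2 hdisj
  have hWT : W ≤ W.comap T := iSup_le fun μ w hw => Submodule.mem_comap.2 <| by
    rw [Module.End.mem_eigenspace_iff.1 hw]
    exact W.smul_mem μ (Submodule.mem_iSup_of_mem μ hw)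
  have hmaps : ∀ v ∈ B.orthogonal W, T v ∈ B.orthogonal W := fun v hv w hw =>
    (hT w v).symm.trans (hv _ (hWT hw))
  by_contra hne
  have : Nontrivial (B.orthogonal W) := by
    rw [Submodule.nontrivial_iff_ne_bot]
    intro h
    exact hne (by simpa [h] using hcompl.sup_eq_top)
  obtain ⟨μ, hμ⟩ := exists_hasEigenvalue_of_isSelfAdjoint (B := B.restrict (B.orthogonal W))
    (T := T.restrict hmaps) (fun v hv => hB v (by simpa using hv)) (fun v w => hT v w)
  obtain ⟨v, hv⟩ := hμ.exists_hasEigenvector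
  have hvW : (v : M) ∈ W := Submodule.mem_iSup_of_mem μ <|
    Module.End.mem_eigenspace_iff.2 (congrArg Subtype.val hv.apply_eq_smul)
  exact hv.2 (Subtype.ext (Submodule.disjoint_def.1 hdisj v hvW v.2))

theorem exists_isGreatest_hasEigenvalue_of_isSelfAdjoint [Nontrivial M]
    (hB : B.toQuadraticMap.PosDef) (hT : B.IsSelfAdjoint T) :
    ∃ μ, IsGreatest {μ | T.HasEigenvalue μ} μ := by
  obtain ⟨μ, hμ, hmax⟩ := Set.exists_max_image {μ | T.HasEigenvalue μ} id
    T.finite_hasEigenvalue (exists_hasEigenvalue_of_isSelfAdjoint hB hT)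
  exact ⟨μ, hμ, hmax⟩

end SelfAdjoint

@[elab_as_elim]
theorem layer_induction {ι K : Type*} [Finite ι] [AddCommGroup K] [LinearOrder K]
    [IsOrderedAddMonoid K] {motive : (ι → K) → Prop} (zero : motive 0)
    (add_indicator : ∀ (w : ι → K) (A : Finset ι) (c : K), 0 ≤ w → 0 < c → (∀ i ∉ A, w i = 0) →
      motive w → motive (w + Set.indicator A fun _ => c))
    (w : ι → K) (hw : 0 ≤ w) : motive w := by
  classical
  have := Fintype.ofFinite ι
  induction h : Finset.card {i | w i ≠ 0} using Nat.strong_induction_on generalizing w with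
  | _ n ih =>
  subst h
  set A : Finset ι := {i | w i ≠ 0} with hA
  rcases A.eq_empty_or_nonempty with hempty | hne
  · convert zero
    ext i
    simpa [hA] using Finset.eq_empty_iff_forall_notMem.1 hempty i
  · obtain ⟨j, hj, hmin⟩ := A.exists_min_image w hne
    have hj0 : w j ≠ 0 := by simpa [hA] using hj
    have hmem {i : ι} : i ∈ A ↔ w i ≠ 0 := by simp [hA]
    set w' : ι → K := w - Set.indicator A fun _ => w j with hw'
    have hw'_of_mem {i : ι} (hi : i ∈ A) : w' i = w i - w j := by simp [hw', hi]
    have hw'_of_notMem {i : ι} (hi : i ∉ A) : w' i = 0 := by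
      simpa [hw', hi] using hmem.not_left.1 hi
    have hw'_nonneg : 0 ≤ w' := fun i => by
      by_cases hi : i ∈ A
      · exact (hw'_of_mem hi).symm ▸ sub_nonneg.2 (hmin i hi)
      · exact (hw'_of_notMem hi).ge
    have hlt : Finset.card {i | w' i ≠ 0} < A.card := by
      refine Finset.card_lt_card (Finset.ssubset_iff_of_subset ?_ |>.2 ⟨j, hj, ?_⟩)
      · intro i hi
        by_contra hiA
        exact (Finset.mem_filter.1 hi).2 (hw'_of_notMem hiA)
      · simp [hw'_of_mem hj]
    have := add_indicator w' A (w j) hw'_nonneg (lt_of_le_of_ne (hw j) hj0.symm)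
      (fun i => hw'_of_notMem) (ih _ hlt w' hw'_nonneg rfl)
    rwa [hw', sub_add_cancel] at this

theorem min_add_indicator_apply {ι K : Type*} [AddCommGroup K] [LinearOrder K]
    [IsOrderedAddMonoid K] [DecidableEq ι] {w : ι → K} {A : Finset ι} (hw : 0 ≤ w)
    (hwA : ∀ i ∉ A, w i = 0) {c : K} (hc : 0 ≤ c) (i j : ι) :
    min ((w + Set.indicator A fun _ => c : ι → K) i) ((w + Set.indicator A fun _ => c : ι → K) j) =
      min (w i) (w j) + if i ∈ A ∧ j ∈ A then c else 0 := by
  by_cases hi : i ∈ A <;> by_cases hj : j ∈ A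
  · simp [hi, hj, min_add_add_right]
  · simp [hi, hj, hwA, add_nonneg (hw i) hc, show 0 ≤ w i from hw i]
  · simp [hi, hj, hwA, add_nonneg (hw j) hc, show 0 ≤ w j from hw j]
  · simp [hi, hj]

namespace OFGraph

variable {V K : Type*} [Field K] [LinearOrder K] (G : OFGraph V K)

theorem cut_comm (S T : Finset V) : G.cut S T = G.cut T S := by
  rw [cut, Finset.sum_comm]
  exact Finset.sum_congr rfl fun y _ => Finset.sum_congr rfl fun x _ => G.symm x y

section Forms

variable [Fintype V]

theorem sum_b_mul_add (φ ψ : V → K) :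
    ∑ x, ∑ y, G.b x y * (φ x + ψ y) = ∑ x, G.deg x * φ x + ∑ x, G.deg x * ψ x := by
  simp only [mul_add, Finset.sum_add_distrib]
  congr 1
  · simp only [deg, Finset.sum_mul]
  · rw [Finset.sum_comm]
    simp only [deg, Finset.sum_mul, G.symm]

variable [DecidableEq V]

theorem sum_deg_mul_ite (S : Finset V) (c : K) :
    ∑ x, G.deg x * (if x ∈ S then c else 0) = c * G.vol S := by
  simp only [mul_ite, mul_zero, Finset.sum_ite_mem, Finset.univ_inter, vol, Finset.sum_mul,
    mul_comm c]

theorem sum_b_mul_ite (S T : Finset V) (c : K) :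
    ∑ x, ∑ y, G.b x y * (if x ∈ S ∧ y ∈ T then c else 0) = c * G.cut S T := by
  simp only [ite_and, mul_ite, mul_zero, Finset.sum_ite_irrel, Finset.sum_const_zero,
    Finset.sum_ite_mem, Finset.univ_inter, cut, Finset.sum_mul, mul_comm c]

/-- The inner product `⟨f, g⟩ = ∑ x, b(x) f(x) g(x)`, for which the normalized Laplacian is
self-adjoint. -/
def innerForm : LinearMap.BilinForm K (V → K) := Matrix.toBilin' (Matrix.diagonal G.deg)

/-- The adjacency form `∑ x y, b(x, y) f(x) g(y)`, by which the quadratic form of the normalized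
Laplacian differs from the inner product. -/
def adjForm : LinearMap.BilinForm K (V → K) := Matrix.toBilin' (Matrix.of G.b)

theorem innerForm_apply (f g : V → K) : G.innerForm f g = ∑ x, G.deg x * (f x * g x) := by
  simp [innerForm, Matrix.toBilin'_apply, Matrix.diagonal_apply, mul_left_comm, mul_assoc]

theorem adjForm_apply (f g : V → K) : G.adjForm f g = ∑ x, ∑ y, G.b x y * (f x * g y) := by
  simp [adjForm, Matrix.toBilin'_apply, mul_left_comm, mul_assoc]

theorem innerForm_comm (f g : V → K) : G.innerForm f g = G.innerForm g f := by
  simp only [innerForm_apply, mul_comm (f _)]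

theorem adjForm_comm (f g : V → K) : G.adjForm f g = G.adjForm g f := by
  simp only [adjForm_apply, mul_comm (f _)]
  rw [Finset.sum_comm]
  simp only [G.symm]

theorem innerForm_indicator (S : Finset V) :
    G.innerForm (Set.indicator S 1) (Set.indicator S 1) = G.vol S := by
  simp [innerForm_apply, Set.indicator_apply, vol]

theorem adjForm_indicator (S T : Finset V) :
    G.adjForm (Set.indicator S 1) (Set.indicator T 1) = G.cut S T := by
  simp only [adjForm_apply, Set.indicator_apply, Finset.mem_coe, Pi.one_apply,
    ite_zero_mul_ite_zero, mul_one, sum_b_mul_ite, one_mul]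

theorem innerForm_sub_self_of_mul_eq_zero {u v : V → K} (huv : u * v = 0) :
    G.innerForm (u - v) (u - v) = G.innerForm u u + G.innerForm v v := by
  simp only [innerForm_apply, ← Finset.sum_add_distrib]
  refine Finset.sum_congr rfl fun x _ => ?_
  have hx : u x * v x = 0 := congrFun huv x
  simp only [Pi.sub_apply]
  linear_combination -2 * G.deg x * hx

theorem adjForm_sub_self (u v : V → K) :
    G.adjForm (u - v) (u - v) = G.adjForm u u + G.adjForm v v - 2 * G.adjForm u v := by
  simp only [map_sub, LinearMap.sub_apply]
  rw [G.adjForm_comm v u]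
  ring

theorem sum_b_mul_sq_add_sq (u v : V → K) :
    ∑ x, ∑ y, G.b x y * (u x ^ 2 + v y ^ 2) = G.innerForm u u + G.innerForm v v := by
  simp only [sum_b_mul_add, innerForm_apply, sq]

end Forms

variable [IsStrictOrderedRing K]

theorem cut_nonneg (S T : Finset V) : 0 ≤ G.cut S T :=
  Finset.sum_nonneg fun x _ => Finset.sum_nonneg fun y _ => G.nonneg x y

variable [Fintype V]

theorem deg_nonneg (x : V) : 0 ≤ G.deg x := Finset.sum_nonneg fun y _ => G.nonneg x y

theorem deg_mul_p (x y : V) : G.deg x * G.p x y = G.b x y :=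
  mul_div_cancel_of_imp' fun h =>
    (Finset.sum_eq_zero_iff_of_nonneg fun y _ => G.nonneg x y).1 h y (Finset.mem_univ y)

theorem deg_mul_laplacian (f : V → K) (x : V) :
    G.deg x * G.laplacian f x = G.deg x * f x - ∑ y, G.b x y * f y := by
  have hterm (y : V) : G.deg x * ((f x - f y) * G.p x y) = G.b x y * f x - G.b x y * f y := by
    rw [← G.deg_mul_p]; ring
  simp only [laplacian, LinearMap.coe_mk, AddHom.coe_mk, Finset.mul_sum, hterm,
    Finset.sum_sub_distrib]
  rw [← Finset.sum_mul, deg]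

theorem vol_nonneg (S : Finset V) : 0 ≤ G.vol S := Finset.sum_nonneg fun x _ => G.deg_nonneg x

theorem cut_add_cut_le_vol (S : Finset V) {T U : Finset V} (h : Disjoint T U) :
    G.cut S T + G.cut S U ≤ G.vol S := by
  classical
  rw [cut, cut, vol, ← Finset.sum_add_distrib]
  refine Finset.sum_le_sum fun x _ => ?_
  rw [← Finset.sum_union h]
  exact Finset.sum_le_univ_sum_of_nonneg (G.nonneg x)

theorem two_mul_cut_le_vol_add_vol (S T : Finset V) : 2 * G.cut S T ≤ G.vol S + G.vol T := by
  have hS := G.cut_add_cut_le_vol S (Finset.disjoint_empty_right T)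
  have hT := G.cut_add_cut_le_vol T (Finset.disjoint_empty_right S)
  rw [G.cut_comm T S] at hT
  linarith [G.cut_nonneg S ∅, G.cut_nonneg T ∅]

variable [DecidableEq V]

theorem innerForm_laplacian (f g : V → K) :
    G.innerForm f (G.laplacian g) = G.innerForm f g - G.adjForm f g := by
  simp only [innerForm_apply, adjForm_apply, ← Finset.sum_sub_distrib]
  refine Finset.sum_congr rfl fun x _ => ?_
  rw [mul_left_comm, deg_mul_laplacian, mul_sub, Finset.mul_sum, mul_left_comm]
  simp only [mul_left_comm]

theorem isSelfAdjoint_laplacian : G.innerForm.IsSelfAdjoint G.laplacian := fun f g => by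
  rw [G.innerForm_comm _ g, innerForm_laplacian, innerForm_laplacian,
    G.innerForm_comm f g, G.adjForm_comm f g]

theorem innerForm_self_nonneg (f : V → K) : 0 ≤ G.innerForm f f := by
  rw [innerForm_apply]
  exact Finset.sum_nonneg fun x _ => mul_nonneg (G.deg_nonneg x) (mul_self_nonneg (f x))

theorem posDef_innerForm (hG : ∀ x, ¬ G.IsIsolated x) : G.innerForm.toQuadraticMap.PosDef := by
  intro f hf
  obtain ⟨x, hx⟩ := Function.ne_iff.1 hf
  have hterm (y : V) : 0 ≤ G.deg y * (f y * f y) := mul_nonneg (G.deg_nonneg y) (mul_self_nonneg _)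
  rw [LinearMap.BilinMap.toQuadraticMap_apply, innerForm_apply]
  exact Finset.sum_pos' (fun y _ => hterm y) ⟨x, Finset.mem_univ x,
    mul_pos ((G.deg_nonneg x).lt_of_ne' (hG x)) (mul_self_pos.2 hx)⟩

theorem adjForm_nonneg {u v : V → K} (hu : 0 ≤ u) (hv : 0 ≤ v) : 0 ≤ G.adjForm u v := by
  rw [adjForm_apply]
  exact Finset.sum_nonneg fun x _ => Finset.sum_nonneg fun y _ =>
    mul_nonneg (G.nonneg x y) (mul_nonneg (hu x) (hv y))

theorem sq_sum_b_mul_abs_sq_sub_sq_le (u v : V → K) :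
    (∑ x, ∑ y, G.b x y * |u x ^ 2 - v y ^ 2|) ^ 2 ≤
      (G.innerForm u u + G.innerForm v v) ^ 2 - (2 * G.adjForm u v) ^ 2 := by
  have hsub : ∑ x, ∑ y, G.b x y * (u x - v y) ^ 2 =
      G.innerForm u u + G.innerForm v v - 2 * G.adjForm u v := by
    simp only [← sum_b_mul_sq_add_sq, adjForm_apply, Finset.mul_sum, ← Finset.sum_sub_distrib]
    refine Finset.sum_congr rfl fun x _ => Finset.sum_congr rfl fun y _ => ?_
    ring
  have hadd : ∑ x, ∑ y, G.b x y * (u x + v y) ^ 2 =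
      G.innerForm u u + G.innerForm v v + 2 * G.adjForm u v := by
    simp only [← sum_b_mul_sq_add_sq, adjForm_apply, Finset.mul_sum, ← Finset.sum_add_distrib]
    refine Finset.sum_congr rfl fun x _ => Finset.sum_congr rfl fun y _ => ?_
    ring
  rw [sq_sub_sq, mul_comm, ← hsub, ← hadd]
  simp only [← Fintype.sum_prod_type']
  refine Finset.sum_sq_le_sum_mul_sum_of_sq_le_mul _
    (fun e _ => mul_nonneg (G.nonneg _ _) (sq_nonneg _))
    (fun e _ => mul_nonneg (G.nonneg _ _) (sq_nonneg _)) fun e _ => ?_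
  rw [mul_pow, sq_abs]
  exact le_of_eq (by ring)

variable [Nontrivial V]

theorem dualCheeger_nonneg : 0 ≤ G.dualCheeger := by
  obtain ⟨P, hP⟩ := disjointPairs_nonempty V
  refine le_trans ?_ (Finset.le_sup' _ hP)
  exact div_nonneg (mul_nonneg zero_le_two (G.cut_nonneg _ _))
    (add_nonneg (G.vol_nonneg _) (G.vol_nonneg _))

theorem dualCheeger_le_one : G.dualCheeger ≤ 1 :=
  Finset.sup'_le _ _ fun _ _ => div_le_one_of_le₀ (G.two_mul_cut_le_vol_add_vol _ _)
    (add_nonneg (G.vol_nonneg _) (G.vol_nonneg _))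

theorem two_mul_cut_le_dualCheeger_mul {S T : Finset V} (h : Disjoint S T) :
    2 * G.cut S T ≤ G.dualCheeger * (G.vol S + G.vol T) := by
  have hvol := add_nonneg (G.vol_nonneg S) (G.vol_nonneg T)
  have hrhs := mul_nonneg G.dualCheeger_nonneg hvol
  rcases S.eq_empty_or_nonempty with rfl | hS
  · simpa [cut] using hrhs
  rcases T.eq_empty_or_nonempty with rfl | hT
  · simpa [cut] using hrhs
  rcases hvol.eq_or_lt with h0 | hpos
  · exact (G.two_mul_cut_le_vol_add_vol S T).trans (h0 ▸ hrhs)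
  · rw [← div_le_iff₀ hpos]
    exact Finset.le_sup'
      (fun P : Finset V × Finset V => 2 * G.cut P.1 P.2 / (G.vol P.1 + G.vol P.2))
      (by simp [disjointPairs, hS, hT, h] : (S, T) ∈ disjointPairs V)

theorem two_mul_sum_b_mul_min_le {u v : V → K} (hu : 0 ≤ u) (hv : 0 ≤ v) (huv : u * v = 0) :
    2 * ∑ x, ∑ y, G.b x y * min (u x) (v y) ≤
      G.dualCheeger * (∑ x, G.deg x * u x + ∑ x, G.deg x * v x) := by
  -- Both functions are sliced at common heights, so they are treated as one function on `V ⊕ V`.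
  suffices key : ∀ w : V ⊕ V → K, 0 ≤ w → (∀ x, w (.inl x) * w (.inr x) = 0) →
      2 * ∑ x, ∑ y, G.b x y * min (w (.inl x)) (w (.inr y)) ≤
        G.dualCheeger * (∑ x, G.deg x * w (.inl x) + ∑ x, G.deg x * w (.inr x)) from
    key (Sum.elim u v) (Sum.rec hu hv) (congrFun huv)
  intro w hw
  refine layer_induction ?_ ?_ w hw
  · simp
  intro w A c hw hc hwA ih hdisj
  have hAdisj (x : V) (hl : .inl x ∈ A) : .inr x ∉ A := fun hr => by
    have hmul := hdisj x
    simp only [Pi.add_apply, Set.indicator_of_mem (Finset.mem_coe.2 hl),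
      Set.indicator_of_mem (Finset.mem_coe.2 hr)] at hmul
    have hpos (i : V ⊕ V) : 0 < w i + c := add_pos_of_nonneg_of_pos (hw i) hc
    exact (mul_pos (hpos _) (hpos _)).ne' hmul
  have hwdisj (x : V) : w (.inl x) * w (.inr x) = 0 := by
    by_cases hl : .inl x ∈ A
    · rw [hwA _ (hAdisj x hl), mul_zero]
    · rw [hwA _ hl, zero_mul]
  have hcut := G.two_mul_cut_le_dualCheeger_mul (S := A.toLeft) (T := A.toRight)
    (Finset.disjoint_left.2 fun x hl hr =>
      hAdisj x (Finset.mem_toLeft.1 hl) (Finset.mem_toRight.1 hr))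
  simp only [min_add_indicator_apply hw hwA hc.le, mul_add, Finset.sum_add_distrib,
    ← Finset.mem_toLeft, ← Finset.mem_toRight, G.sum_b_mul_ite]
  simp only [Pi.add_apply, Set.indicator_apply, Finset.mem_coe, mul_add, Finset.sum_add_distrib,
    ← Finset.mem_toLeft, ← Finset.mem_toRight, G.sum_deg_mul_ite]
  linarith [ih hwdisj, mul_le_mul_of_nonneg_left hcut hc.le]

theorem two_mul_dualCheeger_le_of_innerForm_laplacian_le (hG : ∀ x, ¬ G.IsIsolated x) {lam : K}
    (hlam : ∀ f, G.innerForm f (G.laplacian f) ≤ lam * G.innerForm f f) :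
    2 * G.dualCheeger ≤ lam := by
  obtain ⟨⟨S, T⟩, hP, hmax⟩ := Finset.exists_mem_eq_sup' (disjointPairs_nonempty V)
    fun P => 2 * G.cut P.1 P.2 / (G.vol P.1 + G.vol P.2)
  obtain ⟨hS, -, hdisj⟩ : S.Nonempty ∧ T.Nonempty ∧ Disjoint S T := by
    simpa [disjointPairs] using hP
  set f : V → K := Set.indicator S 1 - Set.indicator T 1 with hf
  have hmul : (Set.indicator S 1 * Set.indicator T 1 : V → K) = 0 := by
    funext x
    by_cases hx : x ∈ S
    · simp [Finset.disjoint_left.1 hdisj hx]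
    · simp [hx]
  have hinner : G.innerForm f f = G.vol S + G.vol T := by
    rw [hf, G.innerForm_sub_self_of_mul_eq_zero hmul, innerForm_indicator, innerForm_indicator]
  have hadj : G.adjForm f f = G.cut S S + G.cut T T - 2 * G.cut S T := by
    simp only [hf, adjForm_sub_self, adjForm_indicator]
  have hvol : 0 < G.vol S + G.vol T :=
    add_pos_of_pos_of_nonneg (Finset.sum_pos (fun x _ => (G.deg_nonneg x).lt_of_ne' (hG x)) hS)
      (G.vol_nonneg T)
  have hrayleigh := hlam f
  rw [innerForm_laplacian, hinner, hadj] at hrayleigh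
  rw [dualCheeger, hmax, ← mul_div_assoc, div_le_iff₀ hvol]
  have hcutS := G.cut_add_cut_le_vol S hdisj
  have hcutT := G.cut_add_cut_le_vol T hdisj
  rw [G.cut_comm T S] at hcutT
  linarith

theorem one_sub_dualCheeger_mul_le_sum_b_mul_abs {u v : V → K} (huv : u * v = 0) :
    (1 - G.dualCheeger) * (G.innerForm u u + G.innerForm v v) ≤
      ∑ x, ∑ y, G.b x y * |u x ^ 2 - v y ^ 2| := by
  have hcoarea := G.two_mul_sum_b_mul_min_le (u := u ^ 2) (v := v ^ 2)
    (fun x => sq_nonneg _) (fun x => sq_nonneg _) (by rw [← mul_pow, huv, zero_pow two_ne_zero])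
  have habs : ∑ x, ∑ y, G.b x y * |u x ^ 2 - v y ^ 2| = G.innerForm u u + G.innerForm v v -
      2 * ∑ x, ∑ y, G.b x y * min (u x ^ 2) (v y ^ 2) := by
    simp only [← sum_b_mul_sq_add_sq, Finset.mul_sum, ← Finset.sum_sub_distrib]
    refine Finset.sum_congr rfl fun x _ => Finset.sum_congr rfl fun y _ => ?_
    rw [← max_sub_min_eq_abs', ← min_add_max (u x ^ 2)]
    ring
  rw [← sum_b_mul_add] at hcoarea
  simp only [Pi.pow_apply, sum_b_mul_sq_add_sq] at hcoarea
  rw [habs]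
  linarith

theorem sq_add_sq_adjForm_le {u v : V → K} (huv : u * v = 0) :
    ((1 - G.dualCheeger) * (G.innerForm u u + G.innerForm v v)) ^ 2 + (2 * G.adjForm u v) ^ 2 ≤
      (G.innerForm u u + G.innerForm v v) ^ 2 := by
  have hnonneg := mul_nonneg (sub_nonneg.2 G.dualCheeger_le_one)
    (add_nonneg (G.innerForm_self_nonneg u) (G.innerForm_self_nonneg v))
  have hsq := pow_le_pow_left₀ hnonneg (G.one_sub_dualCheeger_mul_le_sum_b_mul_abs huv) 2
  exact le_sub_iff_add_le.1 (hsq.trans (G.sq_sum_b_mul_abs_sq_sub_sq_le u v))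

theorem le_one_add_of_hasEigenvalue_laplacian (hG : ∀ x, ¬ G.IsIsolated x) {μ s : K}
    (hμ : G.laplacian.HasEigenvalue μ) (hs : 0 ≤ s) (hs_sq : s ^ 2 = 1 - (1 - G.dualCheeger) ^ 2) :
    μ ≤ 1 + s := by
  obtain ⟨f, hf⟩ := hμ.exists_hasEigenvector
  have hmul : f⁺ * f⁻ = 0 := funext fun x => by
    rcases le_total 0 (f x) with h | h <;> simp [h]
  have hu : 0 ≤ f⁺ := posPart_nonneg f
  have hv : 0 ≤ f⁻ := negPart_nonneg f
  have hinner : G.innerForm f f = G.innerForm f⁺ f⁺ + G.innerForm f⁻ f⁻ := by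
    rw [← G.innerForm_sub_self_of_mul_eq_zero hmul, posPart_sub_negPart]
  have hadj : -(2 * G.adjForm f⁺ f⁻) ≤ G.adjForm f f := by
    have := G.adjForm_sub_self f⁺ f⁻
    rw [posPart_sub_negPart] at this
    linarith [G.adjForm_nonneg hu hu, G.adjForm_nonneg hv hv]
  have hpos : 0 < G.innerForm f f := G.posDef_innerForm hG f hf.2
  have hrayleigh : μ * G.innerForm f f = G.innerForm f f - G.adjForm f f := by
    rw [← innerForm_laplacian, hf.apply_eq_smul, map_smul, smul_eq_mul]
  have hbound : 2 * G.adjForm f⁺ f⁻ ≤ s * G.innerForm f f := by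
    refine le_of_sq_le_sq ?_ (mul_nonneg hs hpos.le)
    have hsq := G.sq_add_sq_adjForm_le hmul
    rw [← hinner, mul_pow (1 - _)] at hsq
    rw [mul_pow s, hs_sq]
    linarith
  refine le_of_mul_le_mul_right ?_ hpos
  linarith

end OFGraph

theorem theorem2 {V K : Type*} [Fintype V] [DecidableEq V] [Nontrivial V]
    [Field K] [LinearOrder K] [IsStrictOrderedRing K] [IsRealClosed K]
    (G : OFGraph V K) (hG : ∀ x, ¬ G.IsIsolated x) :
    ∃ lam : K, IsGreatest {μ : K | G.laplacian.HasEigenvalue μ} lam ∧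
      2 * G.dualCheeger ≤ lam ∧
      ∃ s : K, 0 ≤ s ∧ s ^ 2 = 1 - (1 - G.dualCheeger) ^ 2 ∧ lam ≤ 1 + s := by
  have hB := G.posDef_innerForm hG
  have hT := G.isSelfAdjoint_laplacian
  obtain ⟨lam, hlam⟩ := exists_isGreatest_hasEigenvalue_of_isSelfAdjoint hB hT
  have htop := iSup_eigenspace_eq_top_of_isSelfAdjoint hB ⟨G.innerForm_comm⟩ hT
  have hrayleigh := apply_self_apply_le_of_iSup_eigenspace_eq_top
    G.innerForm_self_nonneg hT htop hlam.2
  have hnonneg : 0 ≤ 1 - (1 - G.dualCheeger) ^ 2 := sub_nonneg.2 <|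
    pow_le_one₀ (sub_nonneg.2 G.dualCheeger_le_one) (sub_le_self 1 G.dualCheeger_nonneg)
  obtain ⟨r, hr⟩ := IsSquare.of_nonneg hnonneg
  have hs_sq : |r| ^ 2 = 1 - (1 - G.dualCheeger) ^ 2 := by rw [sq_abs, hr, sq]
  exact ⟨lam, hlam, G.two_mul_dualCheeger_le_of_innerForm_laplacian_le hG hrayleigh,
    |r|, abs_nonneg r, hs_sq,
    G.le_one_add_of_hasEigenvalue_laplacian hG hlam.1 (abs_nonneg r) hs_sq⟩
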